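/- Let $0\le\alpha<\pi/2$ and let the root be the origin of the plane. A path is a rectifiable curve (given by a Lipschitz parametrization); it is called angle-restricted if at almost every point the angle between the vector from that point to the root and the tangent vector of the path is at most $\alpha$. The spiral region $\mathcal R_p$ of a point $p$ is the set of all points reachable from $p$ by an angle-restricted path. The right spiral through a point with polar coordinates $(R,\phi)$ is the curve $s\mapsto (Re^{-s},\,\phi+s\tan\alpha)$, and the left spiral is $s\mapsto (Re^{-s},\,\phi-s\tan\alpha)$; the spirals through the root are constant. A spiral segment is the part of a right or left spiral over a bounded parameter interval, traversed with increasing $s$, that is, towards the root. (1) For every point $p$ and every $q\in\mathcal R_p$ there is a shortest angle-restricted path from $p$ to $q$, and every such shortest path consists of a straight segment followed by a spiral segment, where either segment can have length zero. (2) Let $t_1,\dots,t_n$ be points of the plane (the terminals). A flux tree is a finite rooted tree whose nodes are placed in the plane, with its root node at the origin and each terminal being the position of some node (further nodes, the Steiner nodes, are allowed), together with an angle-restricted path (an arc) from each node other than the root to its parent. Its length is the total length of its arcs. A flux tree is optimal if its length is minimal among all flux trees with the same $\alpha$ and the same terminals. Then every optimal flux tree consists only of straight segments and spiral segments; more precisely,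 each of its arcs is a straight segment followed by a spiral segment, where either segment can have length zero. -/

import Mathlib

namespace FluxTrees

/-- The length of a path parametrized over `[0, 1]`. -/
noncomputable def pathLength (γ : ℝ → ℂ) : ENNReal :=
  eVariationOn γ (Set.Icc 0 1)

/-- `γ`, restricted to `[0, 1]`, is an angle-restricted path from `p` to `q`. The plane is `ℂ` and
the root is the origin. A path is a rectifiable curve, given by a Lipschitz parametrization, and
at almost every time at which it has a (nonzero) tangent vector the angle between the vector from
the current point to the root and the tangent vector is at most `α`. -/
structure IsAngleRestrictedPath (α : ℝ) (γ : ℝ → ℂ) (p q : ℂ) : Prop where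
  source : γ 0 = p
  target : γ 1 = q
  lipschitz : ∃ K : NNReal, LipschitzOnWith K γ (Set.Icc 0 1)
  angle_le : ∀ᵐ t ∂(MeasureTheory.volume.restrict (Set.Icc (0 : ℝ) 1)),
    deriv γ t ≠ 0 → InnerProductGeometry.angle (0 - γ t) (deriv γ t) ≤ α

/-- The spiral region of `p`: all points reachable from `p` by an angle-restricted path. -/
def spiralRegion (α : ℝ) (p : ℂ) : Set ℂ :=
  {q | ∃ γ : ℝ → ℂ, IsAngleRestrictedPath α γ p q}

/-- `γ` is a shortest angle-restricted path from `p` to `q`. -/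
def IsShortestPath (α : ℝ) (γ : ℝ → ℂ) (p q : ℂ) : Prop :=
  IsAngleRestrictedPath α γ p q ∧
    ∀ δ : ℝ → ℂ, IsAngleRestrictedPath α δ p q → pathLength γ ≤ pathLength δ

/-- The right spiral through `p`; in polar coordinates with `p = (R, φ)`, its point at time `s` is
`(R * exp (-s), φ + tan α * s)`. -/
noncomputable def rightSpiral (α : ℝ) (p : ℂ) (s : ℝ) : ℂ :=
  p * (Real.exp (-s) : ℂ) * Complex.exp (((Real.tan α * s : ℝ) : ℂ) * Complex.I)

/-- The left spiral through `p`: the right spiral with `α` replaced by `-α`. -/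
noncomputable def leftSpiral (α : ℝ) (p : ℂ) (s : ℝ) : ℂ :=
  rightSpiral (-α) p s

/-- On the time interval `[a, b]`, `γ` runs monotonically (possibly with rests) along the straight
segment from `γ a` to `γ b`. The segment may have length zero. -/
def TracesSegment (γ : ℝ → ℂ) (a b : ℝ) : Prop :=
  ∃ φ : ℝ → ℝ, ContinuousOn φ (Set.Icc a b) ∧ MonotoneOn φ (Set.Icc a b) ∧
    ∀ t ∈ Set.Icc a b, γ t = AffineMap.lineMap (γ a) (γ b) (φ t)

/-- On the time interval `[a, b]`, `γ` runs monotonically (possibly with rests), towards the root,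
along a segment of the right spiral or of the left spiral that starts at `γ a`. The segment may have
length zero. -/
def TracesSpiral (α : ℝ) (γ : ℝ → ℂ) (a b : ℝ) : Prop :=
  ∃ φ : ℝ → ℝ, φ a = 0 ∧ ContinuousOn φ (Set.Icc a b) ∧ MonotoneOn φ (Set.Icc a b) ∧
    ((∀ t ∈ Set.Icc a b, γ t = rightSpiral α (γ a) (φ t)) ∨
      (∀ t ∈ Set.Icc a b, γ t = leftSpiral α (γ a) (φ t)))

/-- `γ` is a straight segment followed by a spiral segment (either may have length zero). -/
def IsStraightThenSpiral (α : ℝ) (γ : ℝ → ℂ) : Prop :=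
  ∃ m ∈ Set.Icc (0 : ℝ) 1, TracesSegment γ 0 m ∧ TracesSpiral α γ m 1

/-- A flux tree (angle-restricted Steiner arborescence) with root `0`, terminals `t i` and
restricting angle `α`: a finite rooted tree, given by its parent map, whose nodes (root, terminals
and any number of Steiner nodes) are placed in the plane, with an angle-restricted arc from each
node other than the root to its parent. The value `arc root` plays no role. -/
structure FluxTree (α : ℝ) {n : ℕ} (t : Fin n → ℂ) where
  Node : Type
  [fintypeNode : Fintype Node]
  [decEqNode : DecidableEq Node]
  root : Node
  parent : Node → Node
  parent_root : parent root = root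
  reaches_root : ∀ v : Node, ∃ k : ℕ, parent^[k] v = root
  pos : Node → ℂ
  pos_root : pos root = 0
  terminal_mem : ∀ i : Fin n, ∃ v : Node, pos v = t i
  arc : Node → ℝ → ℂ
  arc_restricted : ∀ v : Node, v ≠ root → IsAngleRestrictedPath α (arc v) (pos v) (pos (parent v))

attribute [instance] FluxTree.fintypeNode FluxTree.decEqNode

/-- The length of a flux tree: the total length of its arcs. -/
noncomputable def FluxTree.length {α : ℝ} {n : ℕ} {t : Fin n → ℂ} (T : FluxTree α t) : ENNReal :=
  ∑ v ∈ Finset.univ.filter (fun v : T.Node => v ≠ T.root), pathLength (T.arc v)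

/-- A flux tree is optimal if it has minimum length among all flux trees on the same terminals. -/
def FluxTree.IsOptimal {α : ℝ} {n : ℕ} {t : Fin n → ℂ} (T : FluxTree α t) : Prop :=
  ∀ T' : FluxTree α t, T.length ≤ T'.length

end FluxTrees

namespace FluxTrees

open MeasureTheory Set Filter Topology

/-! If the target is not the root, a path can be written as `p * exp W`. Let `x` be the log-radius,
`a` its rate of fall and `b` the rate of turning. The angle restriction becomes `|b| ≤ tan α * a`,
and the length density `exp x * √(a² + b²)` does not involve the polar angle. So angular momentum
should keep a value `c` until the restriction binds: it is `m = min c (exp x * sin α)`. Where `m =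
c` the extremal is a line at distance `c` from the root; where `m = exp x * sin α` it is a spiral.
Since `x` decreases, the line comes first.

Minimality follows by calibration. With `n = √(exp x ^ 2 - m ^ 2)`, the form `c * b + (n + (m - c) *
tan α) * a` integrates to a quantity depending only on the endpoints of the lift. It is at most the
length density (`calibration_le`), and equality forces `b = (m / n) * a` (`eq_of_calibration_ge`).
Integration gives both a lower bound for the length and rigidity (`calibration_le_pathLength`). A
suitable `c` exists by `exists_turning_eq`, and `exists_extremal_path` attains the bound, so every
shortest path is an extremal and `isStraightThenSpiral_of_extremal` applies. A target at the root is
reached by a straight segment. For trees, exchanging one arc shows that every arc of an optimal tree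
is a shortest path. -/

/-! ### Lipschitz curves: monotonicity, arc length and length bounds -/

/-- An absolutely continuous function with almost everywhere nonnegative derivative is monotone. -/
theorem monotoneOn_of_ae_hasDerivAt_nonneg {f : ℝ → ℝ}
    (hf : AbsolutelyContinuousOnInterval f 0 1)
    (h : ∀ᵐ t, t ∈ Ioo (0 : ℝ) 1 → ∃ d, HasDerivAt f d t ∧ 0 ≤ d) :
    MonotoneOn f (Icc 0 1) := by
  intro s hs t ht hst
  have hsub : uIcc s t ⊆ uIcc (0 : ℝ) 1 := by
    rw [uIcc_of_le hst, uIcc_of_le zero_le_one]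
    exact Icc_subset_Icc hs.1 ht.2
  have key := (hf.mono hsub).integral_deriv_eq_sub
  have : 0 ≤ ∫ x in s..t, deriv f x := by
    refine intervalIntegral.integral_nonneg_of_ae_restrict hst ?_
    rw [EventuallyLE, ae_restrict_iff' measurableSet_Icc]
    have h0 : ∀ᵐ x : ℝ, x ≠ 0 := by simp [ae_iff, measure_singleton]
    have h1 : ∀ᵐ x : ℝ, x ≠ 1 := by simp [ae_iff, measure_singleton]
    filter_upwards [h, h0, h1] with x hx hx0 hx1 hxst
    obtain ⟨d, hd, hd0⟩ := hx ⟨lt_of_le_of_ne (hs.1.trans hxst.1) hx0.symm,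
      lt_of_le_of_ne (hxst.2.trans ht.2) hx1⟩
    simpa [hd.deriv] using hd0
  linarith

/-- A function that bounds the increments of a curve has derivative at least the speed. -/
theorem norm_le_of_dist_le_sub {γ : ℝ → ℂ} {V : ℝ → ℝ} {t v : ℝ} {w : ℂ} (ht : t ∈ Ioo (0 : ℝ) 1)
    (hγ : HasDerivAt γ w t) (hV : HasDerivAt V v t)
    (h : ∀ s ∈ Icc (0 : ℝ) 1, ∀ t ∈ Icc (0 : ℝ) 1, s ≤ t → dist (γ s) (γ t) ≤ V t - V s) :
    ‖w‖ ≤ v := by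
  have h1 : Tendsto (fun s => ‖slope γ t s‖) (𝓝[>] t) (𝓝 ‖w‖) :=
    ((hasDerivAt_iff_tendsto_slope.1 hγ).mono_left
      (nhdsWithin_mono _ fun x (hx : t < x) => hx.ne')).norm
  have h2 : Tendsto (slope V t) (𝓝[>] t) (𝓝 v) :=
    (hasDerivAt_iff_tendsto_slope.1 hV).mono_left
      (nhdsWithin_mono _ fun x (hx : t < x) => hx.ne')
  refine le_of_tendsto_of_tendsto h1 h2 ?_
  filter_upwards [Ioo_mem_nhdsGT ht.2] with s hs
  have h3 := h t ⟨ht.1.le, ht.2.le⟩ s ⟨(ht.1.trans hs.1).le, hs.2.le⟩ hs.1.le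
  have hpos : 0 < s - t := sub_pos.2 hs.1
  rw [slope_def_module, slope_def_field, norm_smul, norm_inv, Real.norm_of_nonneg hpos.le,
    div_eq_inv_mul, ← dist_eq_norm, dist_comm]
  exact mul_le_mul_of_nonneg_left h3 (inv_nonneg.2 hpos.le)

theorem pathLength_ne_top {γ : ℝ → ℂ} {K : NNReal} (hγ : LipschitzOnWith K γ (Icc 0 1)) :
    pathLength γ ≠ ⊤ := by
  have h := (hγ.locallyBoundedVariationOn) 0 1 ⟨le_rfl, zero_le_one⟩ ⟨zero_le_one, le_rfl⟩
  rwa [inter_self] at h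

/-- The arc length function of a Lipschitz curve. -/
theorem exists_arcLength {γ : ℝ → ℂ} {K : NNReal} (hγ : LipschitzOnWith K γ (Icc 0 1)) :
    ∃ V : ℝ → ℝ, LipschitzOnWith K V (Icc 0 1) ∧ V 0 = 0 ∧ V 1 = (pathLength γ).toReal ∧
      ∀ s ∈ Icc (0 : ℝ) 1, ∀ t ∈ Icc (0 : ℝ) 1, s ≤ t → dist (γ s) (γ t) ≤ V t - V s := by
  have hb : ∀ s ∈ Icc (0 : ℝ) 1, ∀ t ∈ Icc (0 : ℝ) 1, s ≤ t →
      eVariationOn γ (Icc s t) ≤ K * ENNReal.ofReal (t - s) := by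
    intro s hs t ht hst
    have h := LipschitzOnWith.comp_eVariationOn_le (g := id) (s := Icc s t) hγ
      (fun x hx => ⟨hs.1.trans hx.1, hx.2.trans ht.2⟩)
    rwa [eVariationOn_id_Icc] at h
  have hfin : ∀ s ∈ Icc (0 : ℝ) 1, ∀ t ∈ Icc (0 : ℝ) 1, s ≤ t → eVariationOn γ (Icc s t) ≠ ⊤ :=
    fun s hs t ht hst => ((hb s hs t ht hst).trans_lt
      (ENNReal.mul_lt_top ENNReal.coe_lt_top ENNReal.ofReal_lt_top)).ne
  have h0 : (0 : ℝ) ∈ Icc (0 : ℝ) 1 := ⟨le_rfl, zero_le_one⟩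
  have hadd : ∀ s ∈ Icc (0 : ℝ) 1, ∀ t ∈ Icc (0 : ℝ) 1, s ≤ t →
      (eVariationOn γ (Icc 0 t)).toReal - (eVariationOn γ (Icc 0 s)).toReal =
        (eVariationOn γ (Icc s t)).toReal := by
    intro s hs t ht hst
    have h := eVariationOn.Icc_add_Icc γ (s := univ) hs.1 hst (mem_univ s)
    simp only [univ_inter] at h
    rw [← h, ENNReal.toReal_add (hfin 0 h0 s hs hs.1) (hfin s hs t ht hst)]
    ring
  refine ⟨fun t => (eVariationOn γ (Icc 0 t)).toReal, ?_, ?_, rfl, ?_⟩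
  · refine LipschitzOnWith.of_le_add_mul K fun t ht s hs => ?_
    rcases le_total s t with hst | hst
    · have h1 := hadd s hs t ht hst
      have h2 := ENNReal.toReal_mono (ENNReal.mul_ne_top ENNReal.coe_ne_top ENNReal.ofReal_ne_top)
        (hb s hs t ht hst)
      rw [ENNReal.toReal_mul, ENNReal.toReal_ofReal (sub_nonneg.2 hst)] at h2
      rw [Real.dist_eq, abs_of_nonneg (sub_nonneg.2 hst)]
      simp only [ENNReal.coe_toReal] at h2
      linarith
    · have h1 := hadd t ht s hs hst
      have h2 : 0 ≤ (eVariationOn γ (Icc t s)).toReal := ENNReal.toReal_nonneg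
      have h3 : 0 ≤ (K : ℝ) * dist t s := by positivity
      linarith
  · simp [eVariationOn.subsingleton]
  · intro s hs t ht hst
    rw [hadd s hs t ht hst, dist_edist]
    exact ENNReal.toReal_mono (hfin s hs t ht hst)
      (eVariationOn.edist_le γ ⟨le_rfl, hst⟩ ⟨hst, le_rfl⟩)

/-- A curve whose speed is at most the derivative of `F` has length at most the increment of `F`. -/
theorem pathLength_le_of_norm_deriv_le {γ γ' : ℝ → ℂ} {F F' : ℝ → ℝ}
    (hγ : ∀ t, HasDerivAt γ (γ' t) t) (hF : ∀ t, HasDerivAt F (F' t) t)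
    (h : ∀ t ∈ Icc (0 : ℝ) 1, ‖γ' t‖ ≤ F' t) : (pathLength γ).toReal ≤ F 1 - F 0 := by
  have hd : ∀ s ∈ Icc (0 : ℝ) 1, ∀ t ∈ Icc (0 : ℝ) 1, s ≤ t → ‖γ t - γ s‖ ≤ F t - F s := by
    intro s hs t ht hst
    refine image_norm_le_of_norm_deriv_right_le_deriv_boundary (a := s) (b := t)
      (f := fun t => γ t - γ s) (B := fun t => F t - F s) (f' := γ') (B' := F')
      (fun x _ => ((hγ x).sub_const _).continuousAt.continuousWithinAt)
      (fun x _ => ((hγ x).sub_const _).hasDerivWithinAt) (by simp)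
      (fun x => (hF x).sub_const _)
      (fun x hx => h x ⟨hs.1.trans hx.1, hx.2.le.trans ht.2⟩) ⟨hst, le_rfl⟩
  have hmono : MonotoneOn F (Icc 0 1) := fun s hs t ht hst =>
    sub_nonneg.1 ((norm_nonneg _).trans (hd s hs t ht hst))
  -- Each variation sum of `γ` is dominated termwise by that of the monotone `F`, whose variation
  -- telescopes.
  have h1 : pathLength γ ≤ eVariationOn F (Icc 0 1) := by
    refine iSup_le fun u => ?_
    refine le_trans (Finset.sum_le_sum fun i _ => ?_) (eVariationOn.sum_le (n := u.1)
      u.2.2.1 (fun i => u.2.2.2 i))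
    have hm : (u.2 : ℕ → ℝ) i ≤ (u.2 : ℕ → ℝ) (i + 1) := u.2.2.1 (Nat.le_succ i)
    have h2 := hd _ (u.2.2.2 i) _ (u.2.2.2 (i + 1)) hm
    rw [edist_dist, edist_dist, dist_eq_norm, Real.dist_eq]
    exact ENNReal.ofReal_le_ofReal (h2.trans (le_abs_self _))
  have h0 : (0 : ℝ) ∈ Icc (0 : ℝ) 1 := ⟨le_rfl, zero_le_one⟩
  have h01 : (1 : ℝ) ∈ Icc (0 : ℝ) 1 := ⟨zero_le_one, le_rfl⟩
  have h2 := (hmono.eVariationOn_eq h0 h01).le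
  rw [inter_self] at h2
  exact ENNReal.toReal_le_of_le_ofReal (sub_nonneg.2 (hmono h0 h01 zero_le_one)) (h1.trans h2)

theorem ae_hasDerivAt_of_lipschitzOnWith {E : Type*} [NormedAddCommGroup E] [NormedSpace ℝ E]
    [FiniteDimensional ℝ E] {f : ℝ → E} {K : NNReal} (hf : LipschitzOnWith K f (Icc 0 1)) :
    ∀ᵐ t, t ∈ Ioo (0 : ℝ) 1 → HasDerivAt f (deriv f t) t := by
  filter_upwards [hf.ae_differentiableWithinAt_of_mem_real] with t ht hmem
  exact ((ht ⟨hmem.1.le, hmem.2.le⟩).differentiableAt (Icc_mem_nhds hmem.1 hmem.2)).hasDerivAt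

theorem absolutelyContinuous_of_lipschitzOnWith {E : Type*} [NormedAddCommGroup E] {f : ℝ → E}
    {K : NNReal} (hf : LipschitzOnWith K f (Icc 0 1)) : AbsolutelyContinuousOnInterval f 0 1 :=
  LipschitzOnWith.absolutelyContinuousOnInterval (K := K) (by rwa [uIcc_of_le zero_le_one])

/-! ### The angle restriction as a cone condition in logarithmic coordinates -/

/-- The inner product of the inward radial vector with a velocity in logarithmic coordinates. -/
theorem inner_neg_mul (z w : ℂ) : inner ℝ (0 - z) (z * w) = -(‖z‖ ^ 2 * w.re) := by
  rw [Complex.inner, ← Complex.normSq_eq_norm_sq]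
  simp [Complex.normSq_apply]
  ring

/-- The angle restriction in logarithmic coordinates. -/
theorem angle_le_iff {α : ℝ} (hα₀ : 0 ≤ α) (hα : α < Real.pi / 2) {z w : ℂ} (hz : z ≠ 0)
    (hw : w ≠ 0) :
    InnerProductGeometry.angle (0 - z) (z * w) ≤ α ↔
      0 ≤ -w.re ∧ |w.im| ≤ Real.tan α * -w.re := by
  have hcos : 0 < Real.cos α := Real.cos_pos_of_mem_Ioo ⟨by linarith, hα⟩
  have hsin : 0 ≤ Real.sin α := Real.sin_nonneg_of_nonneg_of_le_pi hα₀ (by linarith [Real.pi_pos])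
  have hz' : 0 < ‖z‖ := norm_pos_iff.2 hz
  have hw' : 0 < ‖w‖ := norm_pos_iff.2 hw
  -- Cosine is decreasing on `[0, π]`, so the angle bound is a bound on a cosine; squaring it later
  -- gives the tangent form.
  have h1 : InnerProductGeometry.angle (0 - z) (z * w) ≤ α ↔ Real.cos α * ‖w‖ ≤ -w.re := by
    rw [← Real.strictAntiOn_cos.le_iff_ge ⟨hα₀, by linarith [Real.pi_pos]⟩
      ⟨InnerProductGeometry.angle_nonneg _ _, InnerProductGeometry.angle_le_pi _ _⟩,
      InnerProductGeometry.cos_angle, inner_neg_mul, zero_sub, norm_neg, norm_mul,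
      le_div_iff₀ (by positivity)]
    constructor
    · intro h
      have : ‖z‖ ^ 2 * (Real.cos α * ‖w‖) ≤ ‖z‖ ^ 2 * -w.re := by linarith
      exact le_of_mul_le_mul_left this (by positivity)
    · intro h
      have := mul_le_mul_of_nonneg_left h (sq_nonneg ‖z‖)
      linarith
  have hns : ‖w‖ ^ 2 = w.re ^ 2 + w.im ^ 2 := by
    rw [← Complex.normSq_eq_norm_sq, Complex.normSq_apply]; ring
  have hsc := Real.sin_sq_add_cos_sq α
  rw [h1, Real.tan_eq_sin_div_cos, div_mul_eq_mul_div, le_div_iff₀ hcos]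
  constructor
  · intro h
    have hre : 0 ≤ -w.re := le_trans (by positivity) h
    refine ⟨hre, abs_le_of_sq_le_sq' ?_ (by positivity) |>.2⟩
    have h2 := pow_le_pow_left₀ (by positivity) h 2
    rw [mul_pow, hns] at h2
    rw [mul_pow, sq_abs]
    nlinarith
  · rintro ⟨hre, h⟩
    refine abs_le_of_sq_le_sq' ?_ hre |>.2
    have h2 := pow_le_pow_left₀ (by positivity) h 2
    rw [mul_pow, sq_abs] at h2
    rw [mul_pow, hns]
    nlinarith

/-- Almost everywhere, an angle-restricted path away from the root has a velocity which satisfies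
the angle restriction in logarithmic coordinates. -/
theorem IsAngleRestrictedPath.ae_angle {α : ℝ} (hα₀ : 0 ≤ α) (hα : α < Real.pi / 2) {γ : ℝ → ℂ}
    {p q : ℂ} (h : IsAngleRestrictedPath α γ p q) :
    ∀ᵐ t, t ∈ Ioo (0 : ℝ) 1 → HasDerivAt γ (deriv γ t) t ∧ (γ t ≠ 0 →
      0 ≤ -(deriv γ t / γ t).re ∧
        |(deriv γ t / γ t).im| ≤ Real.tan α * -(deriv γ t / γ t).re) := by
  obtain ⟨K, hK⟩ := h.lipschitz
  have h1 := h.angle_le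
  rw [ae_restrict_iff' measurableSet_Icc] at h1
  filter_upwards [h1, ae_hasDerivAt_of_lipschitzOnWith hK] with t ht1 ht2 ht
  refine ⟨ht2 ht, fun hγ => ?_⟩
  by_cases hd : deriv γ t = 0
  · simp [hd]
  · rw [← angle_le_iff hα₀ hα hγ (div_ne_zero hd hγ), mul_div_cancel₀ _ hγ]
    exact ht1 ⟨ht.1.le, ht.2.le⟩ hd

/-- Along an angle-restricted path the distance to the root does not increase. -/
theorem IsAngleRestrictedPath.norm_le {α : ℝ} (hα₀ : 0 ≤ α) (hα : α < Real.pi / 2) {γ : ℝ → ℂ}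
    {p q : ℂ} (h : IsAngleRestrictedPath α γ p q) {s t : ℝ} (hs : s ∈ Icc (0 : ℝ) 1)
    (ht : t ∈ Icc (0 : ℝ) 1) (hst : s ≤ t) : ‖γ t‖ ≤ ‖γ s‖ := by
  obtain ⟨K, hK⟩ := h.lipschitz
  have hn : AbsolutelyContinuousOnInterval (fun t => ‖γ t‖) 0 1 :=
    absolutelyContinuous_of_lipschitzOnWith (lipschitzWith_one_norm.comp_lipschitzOnWith hK)
  -- The squared norm, unlike the norm, is differentiable even at the root, with derivative zero
  -- there.
  have hmono : MonotoneOn (fun t => -(‖γ t‖ * ‖γ t‖)) (Icc 0 1) := by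
    refine monotoneOn_of_ae_hasDerivAt_nonneg (hn.fun_mul hn).fun_neg ?_
    filter_upwards [h.ae_angle hα₀ hα] with t ht hmem
    obtain ⟨hd, ha⟩ := ht hmem
    refine ⟨_, (hd.norm_sq.neg).congr_of_eventuallyEq (Eventually.of_forall fun t => ?_), ?_⟩
    · simp [pow_two]
    · by_cases hγ : γ t = 0
      · simp [hγ]
      · have h2 := inner_neg_mul (γ t) (deriv γ t / γ t)
        rw [mul_div_cancel₀ _ hγ, zero_sub, inner_neg_left] at h2
        have h3 := mul_nonneg (sq_nonneg ‖γ t‖) (ha hγ).1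
        linarith
  have h4 := hmono hs ht hst
  simp only at h4
  nlinarith [norm_nonneg (γ t), norm_nonneg (γ s)]

/-- The lift of an angle-restricted path to logarithmic coordinates. -/
theorem IsAngleRestrictedPath.exists_lift {α : ℝ} (hα₀ : 0 ≤ α) (hα : α < Real.pi / 2)
    {γ : ℝ → ℂ} {p q : ℂ} (h : IsAngleRestrictedPath α γ p q) (hq : q ≠ 0) :
    ∃ (W : ℝ → ℂ) (C : NNReal), LipschitzOnWith C W (Icc 0 1) ∧ W 0 = 0 ∧
      (∀ t ∈ Icc (0 : ℝ) 1, γ t = p * Complex.exp (W t)) ∧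
      ∀ᵐ t, t ∈ Ioo (0 : ℝ) 1 → ∃ w, HasDerivAt W w t ∧ HasDerivAt γ (γ t * w) t ∧
        0 ≤ -w.re ∧ |w.im| ≤ Real.tan α * -w.re := by
  obtain ⟨K, hK⟩ := h.lipschitz
  have hq' : 0 < ‖q‖ := norm_pos_iff.2 hq
  have hlow : ∀ t ∈ Icc (0 : ℝ) 1, ‖q‖ ≤ ‖γ t‖ := fun t ht => by
    simpa [h.target] using h.norm_le hα₀ hα ht ⟨zero_le_one, le_rfl⟩ ht.2
  have hne : ∀ t ∈ Icc (0 : ℝ) 1, γ t ≠ 0 := fun t ht =>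
    norm_pos_iff.1 (hq'.trans_le (hlow t ht))
  set C : ℝ := K / ‖q‖ with hC
  have hC0 : 0 ≤ C := by positivity
  have hbound : ∀ t ∈ Ioo (0 : ℝ) 1, ‖deriv γ t / γ t‖ ≤ C := by
    intro t ht
    rw [norm_div]
    exact div_le_div₀ K.2 (norm_deriv_le_of_lipschitzOn (Icc_mem_nhds ht.1 ht.2) hK) hq'
      (hlow t ⟨ht.1.le, ht.2.le⟩)
  have hmeas : AEStronglyMeasurable (fun t => deriv γ t / γ t) (volume.restrict (Ioc 0 1)) :=
    ((measurable_deriv γ).aemeasurable.div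
      ((hK.continuousOn.mono Ioc_subset_Icc_self).aemeasurable measurableSet_Ioc)
      ).aestronglyMeasurable
  have h1 : ∀ᵐ x : ℝ, x ≠ 1 := by simp [ae_iff, measure_singleton]
  have hint : IntervalIntegrable (fun t => deriv γ t / γ t) volume 0 1 := by
    rw [intervalIntegrable_iff_integrableOn_Ioc_of_le zero_le_one]
    refine Integrable.of_bound hmeas C ?_
    rw [ae_restrict_iff' measurableSet_Ioc]
    filter_upwards [h1] with t ht1 ht
    exact hbound t ⟨ht.1, lt_of_le_of_ne ht.2 ht1⟩
  have hsub : ∀ s ∈ Icc (0 : ℝ) 1, ∀ t ∈ Icc (0 : ℝ) 1, uIcc s t ⊆ uIcc (0 : ℝ) 1 := by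
    intro s hs t ht
    rw [uIcc_of_le zero_le_one]
    exact ordConnected_Icc.uIcc_subset hs ht
  -- Integrating the logarithmic derivative avoids choosing branches of the logarithm. It is bounded
  -- because `‖γ‖` never falls below `‖q‖`.
  set W : ℝ → ℂ := fun t => ∫ s in (0 : ℝ)..t, deriv γ s / γ s with hW
  have h0 : (0 : ℝ) ∈ Icc (0 : ℝ) 1 := ⟨le_rfl, zero_le_one⟩
  have hWlip : LipschitzOnWith ⟨C, hC0⟩ W (Icc 0 1) := by
    refine LipschitzOnWith.of_dist_le_mul fun t ht s hs => ?_
    rw [dist_eq_norm, hW, intervalIntegral.integral_interval_sub_left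
      (hint.mono_set (hsub 0 h0 t ht)) (hint.mono_set (hsub 0 h0 s hs)), Real.dist_eq]
    refine intervalIntegral.norm_integral_le_of_norm_le_const_ae ?_
    filter_upwards [h1] with x hx1 hx
    have hx' := hsub s hs t ht (uIoc_subset_uIcc hx)
    rw [uIcc_of_le zero_le_one] at hx'
    rw [uIoc, mem_Ioc] at hx
    exact hbound x ⟨(le_min hs.1 ht.1).trans_lt hx.1, lt_of_le_of_ne hx'.2 hx1⟩
  have hWderiv : ∀ᵐ t, t ∈ Ioo (0 : ℝ) 1 → HasDerivAt W (deriv γ t / γ t) t := by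
    filter_upwards [hint.ae_hasDerivAt_integral] with t ht hmem
    rw [uIcc_of_le zero_le_one] at ht
    exact ht ⟨hmem.1.le, hmem.2.le⟩ 0 h0
  have hW0 : W 0 = 0 := by simp [hW]
  refine ⟨W, _, hWlip, hW0, ?_, ?_⟩
  · obtain ⟨L, hL⟩ : ∃ L, LipschitzOnWith L (fun z : ℂ => Complex.exp (-z))
        (Metric.closedBall 0 C) :=
      (Complex.contDiff_exp.comp contDiff_neg).contDiffOn.exists_lipschitzOnWith (n := 1)
        one_ne_zero (convex_closedBall _ _) (isCompact_closedBall _ _)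
    have hmaps : MapsTo W (Icc 0 1) (Metric.closedBall 0 C) := by
      intro t ht
      have h2 := hWlip.dist_le_mul t ht 0 h0
      rw [hW0, Real.dist_eq, sub_zero, abs_of_nonneg ht.1] at h2
      exact h2.trans (mul_le_of_le_one_right hC0 ht.2)
    -- The product `exp (-W) * γ` is absolutely continuous with derivative zero almost everywhere,
    -- hence constantly `p`. The ball is needed because `exp` is only locally Lipschitz.
    have hac := (absolutelyContinuous_of_lipschitzOnWith (hL.comp hWlip hmaps)).fun_smul
      (absolutelyContinuous_of_lipschitzOnWith hK)
    have hne0 : ∀ᵐ x : ℝ, x ≠ 0 := by simp [ae_iff, measure_singleton]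
    obtain ⟨c, hc⟩ := hac.const_of_ae_hasDerivAt_zero (by
      filter_upwards [hWderiv, ae_hasDerivAt_of_lipschitzOnWith hK, hne0, h1]
        with t ht1 ht2 ht3 ht4 hmem
      rw [uIcc_of_le zero_le_one] at hmem
      have hmem' : t ∈ Ioo (0 : ℝ) 1 :=
        ⟨lt_of_le_of_ne hmem.1 ht3.symm, lt_of_le_of_ne hmem.2 ht4⟩
      have hγt := hne t hmem
      have h5 := ((ht1 hmem').neg.cexp).mul (ht2 hmem')
      refine (h5.congr_deriv ?_)
      simp only [Pi.neg_apply]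
      field_simp
      ring)
    rw [uIcc_of_le zero_le_one] at hc
    have hc0 := hc 0 h0
    simp only [Function.comp_apply, hW0, neg_zero, Complex.exp_zero, one_smul, h.source] at hc0
    intro t ht
    have hct := hc t ht
    rw [← hc0] at hct
    simp only [Function.comp_apply, smul_eq_mul] at hct
    rw [← hct, mul_right_comm, ← Complex.exp_add, neg_add_cancel, Complex.exp_zero, one_mul]
  · filter_upwards [hWderiv, h.ae_angle hα₀ hα] with t ht1 ht2 hmem
    have hγt := hne t ⟨hmem.1.le, hmem.2.le⟩
    refine ⟨_, ht1 hmem, ?_, (ht2 hmem).2 hγt⟩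
    rw [mul_div_cancel₀ _ hγt]
    exact (ht2 hmem).1

/-! ### Extremals and the pointwise calibration -/

/-- The angular momentum at log-radius `x` of the extremal with parameter `c`. -/
noncomputable def momentum (α c x : ℝ) : ℝ := min |c| (Real.exp x * Real.sin α)

/-- The radial momentum at log-radius `x` of the extremal with parameter `c`. -/
noncomputable def radialMomentum (α c x : ℝ) : ℝ :=
  Real.sqrt (Real.exp x ^ 2 - momentum α c x ^ 2)

/-- The angle by which the extremal with parameter `c` turns about the root while the log-radius
falls from `x` to `0`. -/
noncomputable def turning (α c x : ℝ) : ℝ :=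
  ∫ s in (0 : ℝ)..x, momentum α c s / radialMomentum α c s

/-- The radial part of the calibration of the extremal with parameter `c`. -/
noncomputable def radialCost (α c x : ℝ) : ℝ :=
  ∫ s in (0 : ℝ)..x, (radialMomentum α c s + (momentum α c s - c) * Real.tan α)

section
variable {α : ℝ}

theorem sin_nonneg_of_restricting (hα₀ : 0 ≤ α) (hα : α < Real.pi / 2) : 0 ≤ Real.sin α :=
  Real.sin_nonneg_of_nonneg_of_le_pi hα₀ (by linarith [Real.pi_pos])

theorem cos_pos_of_restricting (hα₀ : 0 ≤ α) (hα : α < Real.pi / 2) : 0 < Real.cos α :=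
  Real.cos_pos_of_mem_Ioo ⟨by linarith, hα⟩

theorem momentum_nonneg (hα₀ : 0 ≤ α) (hα : α < Real.pi / 2) (c x : ℝ) : 0 ≤ momentum α c x :=
  le_min (abs_nonneg c) (mul_nonneg (Real.exp_pos x).le (sin_nonneg_of_restricting hα₀ hα))

theorem momentum_sq_lt (hα₀ : 0 ≤ α) (hα : α < Real.pi / 2) (c x : ℝ) :
    momentum α c x ^ 2 < Real.exp x ^ 2 := by
  have h1 : momentum α c x ≤ Real.exp x * Real.sin α := min_le_right _ _
  have h2 := pow_le_pow_left₀ (momentum_nonneg hα₀ hα c x) h1 2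
  have h3 : 0 < (Real.exp x * Real.cos α) ^ 2 :=
    pow_pos (mul_pos (Real.exp_pos x) (cos_pos_of_restricting hα₀ hα)) 2
  have h4 := Real.sin_sq_add_cos_sq α
  rw [mul_pow] at h2 h3
  nlinarith

theorem radialMomentum_pos (hα₀ : 0 ≤ α) (hα : α < Real.pi / 2) (c x : ℝ) :
    0 < radialMomentum α c x :=
  Real.sqrt_pos.2 (sub_pos.2 (momentum_sq_lt hα₀ hα c x))

theorem radialMomentum_sq (hα₀ : 0 ≤ α) (hα : α < Real.pi / 2) (c x : ℝ) :
    radialMomentum α c x ^ 2 + momentum α c x ^ 2 = Real.exp x ^ 2 := by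
  rw [radialMomentum, Real.sq_sqrt (sub_nonneg.2 (momentum_sq_lt hα₀ hα c x).le)]
  ring

theorem continuous_momentum : Continuous fun z : ℝ × ℝ => momentum α z.1 z.2 := by
  unfold momentum
  fun_prop

theorem continuous_radialMomentum : Continuous fun z : ℝ × ℝ => radialMomentum α z.1 z.2 := by
  have := continuous_momentum (α := α)
  unfold radialMomentum
  fun_prop

theorem continuous_slope (hα₀ : 0 ≤ α) (hα : α < Real.pi / 2) :
    Continuous fun z : ℝ × ℝ => momentum α z.1 z.2 / radialMomentum α z.1 z.2 :=
  continuous_momentum.div continuous_radialMomentum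
    fun z => (radialMomentum_pos hα₀ hα z.1 z.2).ne'

theorem hasDerivAt_turning (hα₀ : 0 ≤ α) (hα : α < Real.pi / 2) (c x : ℝ) :
    HasDerivAt (turning α c) (momentum α c x / radialMomentum α c x) x := by
  have h : Continuous fun s => momentum α c s / radialMomentum α c s :=
    (continuous_slope hα₀ hα).comp (Continuous.prodMk_right c)
  exact h.integral_hasStrictDerivAt 0 x |>.hasDerivAt

theorem continuous_radialCost_integrand (c : ℝ) :
    Continuous fun s => radialMomentum α c s + (momentum α c s - c) * Real.tan α := by
  have h1 : Continuous fun s => momentum α c s :=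
    continuous_momentum.comp (Continuous.prodMk_right c)
  have h2 : Continuous fun s => radialMomentum α c s :=
    continuous_radialMomentum.comp (Continuous.prodMk_right c)
  fun_prop

theorem hasDerivAt_radialCost (c x : ℝ) :
    HasDerivAt (radialCost α c)
      (radialMomentum α c x + (momentum α c x - c) * Real.tan α) x :=
  (continuous_radialCost_integrand c).integral_hasStrictDerivAt 0 x |>.hasDerivAt

theorem contDiff_radialCost (c : ℝ) : ContDiff ℝ 1 (radialCost α c) := by
  rw [contDiff_one_iff_deriv]
  refine ⟨fun x => (hasDerivAt_radialCost c x).differentiableAt, ?_⟩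
  rw [funext fun x => (hasDerivAt_radialCost (α := α) c x).deriv]
  exact continuous_radialCost_integrand c

theorem contDiff_turning (hα₀ : 0 ≤ α) (hα : α < Real.pi / 2) (c : ℝ) :
    ContDiff ℝ 1 (turning α c) := by
  rw [contDiff_one_iff_deriv]
  refine ⟨fun x => (hasDerivAt_turning hα₀ hα c x).differentiableAt, ?_⟩
  rw [funext fun x => (hasDerivAt_turning hα₀ hα c x).deriv]
  exact (continuous_slope hα₀ hα).comp (Continuous.prodMk_right c)

theorem momentum_of_le {c x : ℝ} (hc : 0 ≤ c) (h : c ≤ Real.exp x * Real.sin α) :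
    momentum α c x = c := by
  rw [momentum, abs_of_nonneg hc, min_eq_left h]

theorem momentum_of_ge {c x : ℝ} (hc : 0 ≤ c) (h : Real.exp x * Real.sin α ≤ c) :
    momentum α c x = Real.exp x * Real.sin α := by
  rw [momentum, abs_of_nonneg hc, min_eq_right h]

/-- In the saturated regime the radial momentum is `exp x * cos α`, so the extremal makes the angle
`α` with the direction to the root: the spiral regime. -/
theorem slope_of_ge (hα₀ : 0 ≤ α) (hα : α < Real.pi / 2) {c x : ℝ} (hc : 0 ≤ c)
    (h : Real.exp x * Real.sin α ≤ c) :
    momentum α c x / radialMomentum α c x = Real.tan α := by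
  have h1 : radialMomentum α c x = Real.exp x * Real.cos α := by
    rw [radialMomentum, momentum_of_ge hc h, Real.sqrt_eq_iff_mul_self_eq_of_pos
      (mul_pos (Real.exp_pos x) (cos_pos_of_restricting hα₀ hα))]
    linear_combination (Real.exp x ^ 2) * Real.sin_sq_add_cos_sq α
  rw [h1, momentum_of_ge hc h, mul_div_mul_left _ _ (Real.exp_pos x).ne',
    Real.tan_eq_sin_div_cos]

/-- The angle between the velocity of the extremal and the direction to the root is at most `α`. -/
theorem slope_le_tan (hα₀ : 0 ≤ α) (hα : α < Real.pi / 2) (c x : ℝ) :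
    momentum α c x / radialMomentum α c x ≤ Real.tan α := by
  have hcos := cos_pos_of_restricting hα₀ hα
  have hn := radialMomentum_pos hα₀ hα c x
  have hm := momentum_nonneg hα₀ hα c x
  have h1 : momentum α c x ≤ Real.exp x * Real.sin α := min_le_right _ _
  have h2 := pow_le_pow_left₀ hm h1 2
  have h3 := radialMomentum_sq hα₀ hα c x
  have h4 := Real.sin_sq_add_cos_sq α
  rw [Real.tan_eq_sin_div_cos, div_le_div_iff₀ hn hcos]
  refine abs_le_of_sq_le_sq' ?_ (mul_nonneg (sin_nonneg_of_restricting hα₀ hα) hn.le) |>.2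
  rw [mul_pow] at h2
  rw [mul_pow, mul_pow]
  nlinarith

/-- Complementary slackness: either the momentum is still `c`, or the angle restriction is active.
This removes the multiplier term along an extremal. -/
theorem momentum_sub_mul_eq_zero (hα₀ : 0 ≤ α) (hα : α < Real.pi / 2) {c : ℝ} (hc : 0 ≤ c)
    (x : ℝ) :
    (momentum α c x - c) * (Real.tan α - momentum α c x / radialMomentum α c x) = 0 := by
  rcases le_total c (Real.exp x * Real.sin α) with h | h
  · rw [momentum_of_le hc h, sub_self, zero_mul]
  · rw [slope_of_ge hα₀ hα hc h, sub_self, mul_zero]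

/-- The calibration inequality. -/
theorem calibration_le (hα₀ : 0 ≤ α) (hα : α < Real.pi / 2) {c : ℝ} (hc : 0 ≤ c) (x : ℝ)
    {a b : ℝ} (hb : b ≤ Real.tan α * a) :
    c * b + (radialMomentum α c x + (momentum α c x - c) * Real.tan α) * a ≤
      Real.exp x * Real.sqrt (a ^ 2 + b ^ 2) := by
  have hmc : momentum α c x ≤ c := (min_le_left _ _).trans_eq (abs_of_nonneg hc)
  -- The two sides differ by `(c - m) * (tan α * a - b)`, a product of nonnegative factors. What
  -- remains is Cauchy–Schwarz for `(n, m)`, a vector of norm `exp x`.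
  have h1 : c * b + (radialMomentum α c x + (momentum α c x - c) * Real.tan α) * a ≤
      radialMomentum α c x * a + momentum α c x * b := by
    nlinarith [mul_nonneg (sub_nonneg.2 hmc) (sub_nonneg.2 hb)]
  refine h1.trans (abs_le_of_sq_le_sq' ?_ (by positivity)).2
  rw [mul_pow, Real.sq_sqrt (by positivity), ← radialMomentum_sq hα₀ hα c x]
  nlinarith [sq_nonneg (radialMomentum α c x * b - momentum α c x * a)]

/-- The equality case of the calibration inequality. -/
theorem eq_of_calibration_ge (hα₀ : 0 ≤ α) (hα : α < Real.pi / 2) {c : ℝ} (hc : 0 ≤ c) (x : ℝ)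
    {a b : ℝ} (hb : b ≤ Real.tan α * a)
    (h : Real.exp x * Real.sqrt (a ^ 2 + b ^ 2) ≤
      c * b + (radialMomentum α c x + (momentum α c x - c) * Real.tan α) * a) :
    b = momentum α c x / radialMomentum α c x * a := by
  have hmc : momentum α c x ≤ c := (min_le_left _ _).trans_eq (abs_of_nonneg hc)
  have hn := radialMomentum_pos hα₀ hα c x
  have h1 : c * b + (radialMomentum α c x + (momentum α c x - c) * Real.tan α) * a ≤
      radialMomentum α c x * a + momentum α c x * b := by
    nlinarith [mul_nonneg (sub_nonneg.2 hmc) (sub_nonneg.2 hb)]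
  have h2 := pow_le_pow_left₀ (by positivity) (h.trans h1) 2
  rw [mul_pow, Real.sq_sqrt (by positivity), ← radialMomentum_sq hα₀ hα c x] at h2
  -- By Lagrange's identity the square of this expression is the defect in Cauchy–Schwarz.
  have h3 : radialMomentum α c x * b - momentum α c x * a = 0 := by
    refine pow_eq_zero_iff two_ne_zero |>.1 (le_antisymm ?_ (sq_nonneg _))
    nlinarith
  field_simp
  linarith

/-- The extremal attains equality in the calibration inequality. -/
theorem calibration_eq (hα₀ : 0 ≤ α) (hα : α < Real.pi / 2) {c : ℝ} (hc : 0 ≤ c) (x : ℝ)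
    {a b : ℝ} (ha : 0 ≤ a) (hb : b = momentum α c x / radialMomentum α c x * a) :
    Real.exp x * Real.sqrt (a ^ 2 + b ^ 2) =
      c * b + (radialMomentum α c x + (momentum α c x - c) * Real.tan α) * a := by
  have hn := radialMomentum_pos hα₀ hα c x
  have h1 := radialMomentum_sq hα₀ hα c x
  have h2 := momentum_sub_mul_eq_zero hα₀ hα hc x
  have hbn : radialMomentum α c x * b = momentum α c x * a := by rw [hb]; field_simp
  have h3 : c * b + (radialMomentum α c x + (momentum α c x - c) * Real.tan α) * a =
      radialMomentum α c x * a + momentum α c x * b := by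
    rw [hb]
    linear_combination a * h2
  have hb0 : 0 ≤ b := by
    rw [hb]
    exact mul_nonneg (div_nonneg (momentum_nonneg hα₀ hα c x) hn.le) ha
  have hm := momentum_nonneg hα₀ hα c x
  rw [h3]
  refine (pow_left_inj₀ (by positivity) (by positivity) two_ne_zero).1 ?_
  rw [mul_pow, Real.sq_sqrt (by positivity), ← h1]
  linear_combination (radialMomentum α c x * b - momentum α c x * a) * hbn

/-- Every admissible turning angle is attained by an extremal. -/
theorem exists_turning_eq (hα₀ : 0 ≤ α) (hα : α < Real.pi / 2) {x₀ x₁ Δ : ℝ} (hx : x₁ ≤ x₀)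
    (hΔ₀ : 0 ≤ Δ) (hΔ : Δ ≤ Real.tan α * (x₀ - x₁)) :
    ∃ c, 0 ≤ c ∧ c ≤ Real.exp x₀ * Real.sin α ∧ turning α c x₀ - turning α c x₁ = Δ := by
  have hsin := sin_nonneg_of_restricting hα₀ hα
  have hdiff : ∀ c, turning α c x₀ - turning α c x₁ =
      ∫ s in x₁..x₀, momentum α c s / radialMomentum α c s := by
    intro c
    have h : Continuous fun s => momentum α c s / radialMomentum α c s :=
      (continuous_slope hα₀ hα).comp (Continuous.prodMk_right c)
    exact intervalIntegral.integral_interval_sub_left (h.intervalIntegrable _ _)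
      (h.intervalIntegrable _ _)
  have hcont : Continuous fun c => turning α c x₀ - turning α c x₁ := by
    simp_rw [hdiff]
    exact intervalIntegral.continuous_parametric_intervalIntegral_of_continuous'
      (f := fun c s => momentum α c s / radialMomentum α c s) (continuous_slope hα₀ hα) x₁ x₀
  -- The two ends for the intermediate value theorem: `c = 0` is radial motion, and `c = exp x₀ *
  -- sin α` is a spiral from the start.
  have h0 : turning α 0 x₀ - turning α 0 x₁ = 0 := by
    rw [hdiff]
    refine intervalIntegral.integral_zero_ae (Eventually.of_forall fun s _ => ?_)
    rw [momentum_of_le le_rfl (mul_nonneg (Real.exp_pos s).le hsin), zero_div]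
  have h1 : turning α (Real.exp x₀ * Real.sin α) x₀ - turning α (Real.exp x₀ * Real.sin α) x₁ =
      Real.tan α * (x₀ - x₁) := by
    rw [hdiff, intervalIntegral.integral_congr (g := fun _ => Real.tan α)]
    · simp [mul_comm]
    · intro s hs
      rw [uIcc_of_le hx] at hs
      exact slope_of_ge hα₀ hα (by positivity)
        (mul_le_mul_of_nonneg_right (Real.exp_le_exp.2 hs.2) hsin)
  obtain ⟨c, hc, hcΔ⟩ := intermediate_value_Icc (mul_nonneg (Real.exp_pos x₀).le hsin)
    hcont.continuousOn (show Δ ∈ Icc _ _ by simp only [h0, h1]; exact ⟨hΔ₀, hΔ⟩)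
  exact ⟨c, hc.1, hc.2, hcΔ⟩

end

/-! ### Integrating the calibration along paths, and a path attaining the bound -/

theorem norm_mul_cexp {p : ℂ} (hp : p ≠ 0) (z : ℂ) :
    ‖p * Complex.exp z‖ = Real.exp (Real.log ‖p‖ + z.re) := by
  rw [norm_mul, Complex.norm_exp, Real.exp_add, Real.exp_log (norm_pos_iff.2 hp)]

theorem norm_eq_sqrt_re_im {σ : ℝ} (hσ : σ ^ 2 = 1) (w : ℂ) :
    ‖w‖ = Real.sqrt ((-w.re) ^ 2 + (σ * w.im) ^ 2) := by
  rw [mul_pow, hσ, Complex.norm_eq_sqrt_sq_add_sq]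
  ring_nf

theorem hasDerivAt_re {W : ℝ → ℂ} {w : ℂ} {t : ℝ} (h : HasDerivAt W w t) :
    HasDerivAt (fun t => (W t).re) w.re t :=
  (Complex.reCLM.hasFDerivAt.comp_hasDerivAt t h)

theorem hasDerivAt_im {W : ℝ → ℂ} {w : ℂ} {t : ℝ} (h : HasDerivAt W w t) :
    HasDerivAt (fun t => (W t).im) w.im t :=
  (Complex.imCLM.hasFDerivAt.comp_hasDerivAt t h)

/-- The image of `W` is compact, and a `C¹` function is Lipschitz on a ball containing it. This
gives absolute continuity of `radialCost` and `turning` along a lift. -/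
theorem exists_lipschitzOnWith_comp_re {f : ℝ → ℝ} (hf : ContDiff ℝ 1 f) {W : ℝ → ℂ} {C : NNReal}
    (hW : LipschitzOnWith C W (Icc 0 1)) (a : ℝ) :
    ∃ L, LipschitzOnWith L (fun t => f (a + (W t).re)) (Icc 0 1) := by
  have hg : ContDiff ℝ 1 fun z : ℂ => f (a + z.re) :=
    hf.comp (contDiff_const.add Complex.reCLM.contDiff)
  obtain ⟨B, hB⟩ := (isCompact_Icc.image_of_continuousOn hW.continuousOn).isBounded.subset_closedBall
    (0 : ℂ)
  obtain ⟨L, hL⟩ := hg.contDiffOn.exists_lipschitzOnWith one_ne_zero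
    (convex_closedBall (0 : ℂ) B) (isCompact_closedBall _ _)
  exact ⟨_, hL.comp hW (mapsTo_iff_image_subset.2 hB)⟩

/-- The calibration bound on the length of a path with a given lift, and its equality case. -/
theorem calibration_le_pathLength {α : ℝ} (hα₀ : 0 ≤ α) (hα : α < Real.pi / 2) {c : ℝ}
    (hc : 0 ≤ c) {σ : ℝ} (hσ : |σ| = 1) {γ : ℝ → ℂ} {p : ℂ} (hp : p ≠ 0) {K C : NNReal}
    (hγ : LipschitzOnWith K γ (Icc 0 1)) {W : ℝ → ℂ} (hW : LipschitzOnWith C W (Icc 0 1))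
    (hW0 : W 0 = 0) (hγW : ∀ t ∈ Icc (0 : ℝ) 1, γ t = p * Complex.exp (W t))
    (hae : ∀ᵐ t, t ∈ Ioo (0 : ℝ) 1 → ∃ w, HasDerivAt W w t ∧ HasDerivAt γ (γ t * w) t ∧
        0 ≤ -w.re ∧ |w.im| ≤ Real.tan α * -w.re) :
    c * (σ * (W 1).im) + (radialCost α c (Real.log ‖p‖) -
        radialCost α c (Real.log ‖p‖ + (W 1).re)) ≤ (pathLength γ).toReal ∧
      ((pathLength γ).toReal ≤ c * (σ * (W 1).im) + (radialCost α c (Real.log ‖p‖) -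
          radialCost α c (Real.log ‖p‖ + (W 1).re)) →
        ∀ t ∈ Icc (0 : ℝ) 1, σ * (W t).im =
          turning α c (Real.log ‖p‖) - turning α c (Real.log ‖p‖ + (W t).re)) := by
  have hσ2 : σ ^ 2 = 1 := by rw [← sq_abs, hσ, one_pow]
  set a := Real.log ‖p‖ with ha
  obtain ⟨V, hVlip, hV0, hV1, hV⟩ := exists_arcLength hγ
  obtain ⟨L, hL⟩ := exists_lipschitzOnWith_comp_re (contDiff_radialCost (α := α) c) hW a
  obtain ⟨M, hM⟩ := exists_lipschitzOnWith_comp_re (contDiff_turning hα₀ hα c) hW a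
  have him : AbsolutelyContinuousOnInterval (fun t => (W t).im) 0 1 :=
    absolutelyContinuous_of_lipschitzOnWith (Complex.imCLM.lipschitz.comp_lipschitzOnWith hW)
  -- Up to a constant, `D` is the excess of arc length over the calibration, so the pointwise
  -- inequality makes it nondecreasing.
  set D : ℝ → ℝ := fun t => V t - c * (σ * (W t).im) + radialCost α c (a + (W t).re) with hD
  have hDac : AbsolutelyContinuousOnInterval D 0 1 :=
    ((absolutelyContinuous_of_lipschitzOnWith hVlip).fun_sub
      ((him.const_mul σ).const_mul c)).fun_add (absolutelyContinuous_of_lipschitzOnWith hL)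
  have hpt : ∀ᵐ t, t ∈ Ioo (0 : ℝ) 1 → ∃ w v, HasDerivAt W w t ∧
      Real.exp (a + (W t).re) * Real.sqrt ((-w.re) ^ 2 + (σ * w.im) ^ 2) ≤ v ∧
      σ * w.im ≤ Real.tan α * -w.re ∧
      HasDerivAt D (v - (c * (σ * w.im) + (radialMomentum α c (a + (W t).re) +
        (momentum α c (a + (W t).re) - c) * Real.tan α) * -w.re)) t := by
    filter_upwards [hae, ae_hasDerivAt_of_lipschitzOnWith hVlip] with t ht1 ht2 ht
    obtain ⟨w, hw, hγ', -, hang⟩ := ht1 ht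
    have hnorm := norm_le_of_dist_le_sub ht hγ' (ht2 ht) hV
    rw [norm_mul, hγW t ⟨ht.1.le, ht.2.le⟩, norm_mul_cexp hp, norm_eq_sqrt_re_im hσ2 w] at hnorm
    refine ⟨w, _, hw, hnorm, ?_, ?_⟩
    · refine (le_abs_self _).trans ?_
      rwa [abs_mul, hσ, one_mul]
    · refine (((ht2 ht).sub (((hasDerivAt_im hw).const_mul σ).const_mul c)).add
        ((hasDerivAt_radialCost (α := α) c (a + (W t).re)).comp t
          ((hasDerivAt_re hw).const_add a))).congr_deriv ?_
      ring
  have hmono : MonotoneOn D (Icc 0 1) := by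
    refine monotoneOn_of_ae_hasDerivAt_nonneg hDac ?_
    filter_upwards [hpt] with t ht1 ht
    obtain ⟨w, v, -, hv, hb, hd⟩ := ht1 ht
    exact ⟨_, hd, sub_nonneg.2 ((calibration_le hα₀ hα hc _ hb).trans hv)⟩
  have h0 : (0 : ℝ) ∈ Icc (0 : ℝ) 1 := ⟨le_rfl, zero_le_one⟩
  have h1 : (1 : ℝ) ∈ Icc (0 : ℝ) 1 := ⟨zero_le_one, le_rfl⟩
  have hD0 : D 0 = radialCost α c a := by simp [hD, hV0, hW0]
  have hD1 : D 1 = (pathLength γ).toReal - c * (σ * (W 1).im) +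
      radialCost α c (a + (W 1).re) := by simp [hD, hV1]
  refine ⟨by linarith [hmono h0 h1 zero_le_one], fun hle => ?_⟩
  -- No total excess means no excess anywhere, so the pointwise equality case holds almost
  -- everywhere and fixes the turning as a function of the log-radius.
  have hconst : ∀ t ∈ Icc (0 : ℝ) 1, D t = D 0 := fun t ht =>
    le_antisymm (by linarith [hmono ht h1 ht.2]) (hmono h0 ht ht.1)
  have hac2 := (him.const_mul σ).fun_add (absolutelyContinuous_of_lipschitzOnWith hM)
  have hne0 : ∀ᵐ x : ℝ, x ≠ 0 := by simp [ae_iff, measure_singleton]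
  have hne1 : ∀ᵐ x : ℝ, x ≠ 1 := by simp [ae_iff, measure_singleton]
  obtain ⟨k, hk⟩ := hac2.const_of_ae_hasDerivAt_zero (by
    filter_upwards [hpt, hne0, hne1] with t ht1 hn0 hn1 hmem
    rw [uIcc_of_le zero_le_one] at hmem
    have ht : t ∈ Ioo (0 : ℝ) 1 := ⟨lt_of_le_of_ne hmem.1 hn0.symm, lt_of_le_of_ne hmem.2 hn1⟩
    obtain ⟨w, v, hw, hv, hb, hd⟩ := ht1 ht
    have hd0 : HasDerivAt D 0 t := by
      refine (hasDerivAt_const t (D 0)).congr_of_eventuallyEq ?_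
      filter_upwards [Icc_mem_nhds ht.1 ht.2] with s hs using hconst s hs
    have hveq := hd.unique hd0
    have hbeq := eq_of_calibration_ge hα₀ hα hc _ hb (by linarith)
    refine (((hasDerivAt_im hw).const_mul σ).add
      ((hasDerivAt_turning hα₀ hα c (a + (W t).re)).comp t
        ((hasDerivAt_re hw).const_add a))).congr_deriv ?_
    rw [hbeq]
    ring)
  rw [uIcc_of_le zero_le_one] at hk
  intro t ht
  have hk0 := hk 0 h0
  have hkt := hk t ht
  simp only [hW0, Complex.zero_im, mul_zero, Complex.zero_re, add_zero, zero_add] at hk0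
  linarith

/-- The minimal turning angle of the lifts of paths from `p` to `q`. -/
theorem abs_arg_div_le_abs_im {p q z : ℂ} (hp : p ≠ 0) (h : q = p * Complex.exp z) :
    |Complex.arg (q / p)| ≤ |z.im| := by
  rw [h, mul_div_cancel_left₀ _ hp]
  by_contra! hlt
  have hle := hlt.trans_le (Complex.abs_arg_le_pi (Complex.exp z))
  have h1 := abs_lt.1 hle
  -- A lift turning by less than `|arg|` turns by less than `π`, so its imaginary part is already
  -- the principal argument.
  rw [Complex.arg_exp, toIocMod_eq_self _ |>.2 (by constructor <;> linarith)] at hlt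
  exact lt_irrefl _ hlt

/-- The extremal path from `p` with parameter `c` that falls by `X` in log-radius. -/
noncomputable def extremalLift (α c ε x X t : ℝ) : ℂ :=
  ((-(X * t) : ℝ) : ℂ) + ((ε * (turning α c x - turning α c (x - X * t)) : ℝ) : ℂ) * Complex.I

theorem extremalLift_re (α c ε x X t : ℝ) : (extremalLift α c ε x X t).re = -(X * t) := by
  simp [extremalLift]

theorem extremalLift_im (α c ε x X t : ℝ) :
    (extremalLift α c ε x X t).im = ε * (turning α c x - turning α c (x - X * t)) := by
  simp [extremalLift]

/-- The log-radius falls at constant rate `X` while the angle follows `turning`. By `calibration_eq`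
the speed is exactly the derivative of the calibration, so the length does not exceed the lower
bound. -/
theorem exists_extremal_path {α : ℝ} (hα₀ : 0 ≤ α) (hα : α < Real.pi / 2) {c : ℝ}
    (hc : 0 ≤ c) {ε : ℝ} (hε : |ε| = 1) {p q : ℂ} (hp : p ≠ 0) {X : ℝ} (hX : 0 ≤ X)
    (hq : q = p * Complex.exp (extremalLift α c ε (Real.log ‖p‖) X 1)) :
    ∃ γ, IsAngleRestrictedPath α γ p q ∧ (pathLength γ).toReal ≤
      c * (turning α c (Real.log ‖p‖) - turning α c (Real.log ‖p‖ - X)) +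
        (radialCost α c (Real.log ‖p‖) - radialCost α c (Real.log ‖p‖ - X)) := by
  have hε2 : ε ^ 2 = 1 := by rw [← sq_abs, hε, one_pow]
  set a := Real.log ‖p‖ with ha
  set k : ℝ → ℝ := fun x => momentum α c x / radialMomentum α c x with hk
  set w : ℝ → ℂ := fun t => ((-X : ℝ) : ℂ) + ((ε * (k (a - X * t) * X) : ℝ) : ℂ) * Complex.I
    with hw
  have hwre : ∀ t, (w t).re = -X := fun t => by simp [hw]
  have hwim : ∀ t, (w t).im = ε * (k (a - X * t) * X) := fun t => by simp [hw]
  have hlin : ∀ t, HasDerivAt (fun t : ℝ => X * t) X t := fun t => by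
    simpa using (hasDerivAt_id t).const_mul X
  have hturn : ∀ t, HasDerivAt (fun t => turning α c (a - X * t)) (k (a - X * t) * -X) t :=
    fun t =>
    HasDerivAt.comp (h₂ := turning α c) t (hasDerivAt_turning hα₀ hα c (a - X * t))
      ((hlin t).const_sub a)
  have hcost : ∀ t, HasDerivAt (fun t => radialCost α c (a - X * t))
      ((radialMomentum α c (a - X * t) + (momentum α c (a - X * t) - c) * Real.tan α) * -X) t :=
    fun t =>
    HasDerivAt.comp (h₂ := radialCost α c) t (hasDerivAt_radialCost c (a - X * t))
      ((hlin t).const_sub a)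
  have hZ : ∀ t, HasDerivAt (extremalLift α c ε a X) (w t) t := by
    intro t
    refine ((hlin t).neg.ofReal_comp.add
      ((((hturn t).const_sub _).const_mul ε).ofReal_comp.mul_const Complex.I)).congr_deriv ?_
    simp [hw]
  set γ : ℝ → ℂ := fun t => p * Complex.exp (extremalLift α c ε a X t) with hγ
  have hγd : ∀ t, HasDerivAt γ (γ t * w t) t := by
    intro t
    refine ((hZ t).cexp.const_mul p).congr_deriv ?_
    simp only [hγ]
    ring
  have hkcont : Continuous k :=
    (continuous_slope hα₀ hα).comp (Continuous.prodMk_right c)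
  have hγ1 : ContDiff ℝ 1 γ := by
    rw [contDiff_one_iff_deriv]
    refine ⟨fun t => (hγd t).differentiableAt, ?_⟩
    rw [funext fun t => (hγd t).deriv]
    have h1 : Continuous γ := continuous_iff_continuousAt.2 fun t => (hγd t).continuousAt
    have h2 : Continuous w := by fun_prop
    exact h1.mul h2
  refine ⟨γ, ⟨?_, hq.symm, ?_, ?_⟩, ?_⟩
  · simp [hγ, extremalLift]
  · exact hγ1.contDiffOn.exists_lipschitzOnWith one_ne_zero (convex_Icc _ _) isCompact_Icc
  · refine Eventually.of_forall fun t hd => ?_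
    rw [(hγd t).deriv] at hd ⊢
    rw [angle_le_iff hα₀ hα (left_ne_zero_of_mul hd) (right_ne_zero_of_mul hd), hwre, hwim,
      neg_neg, abs_mul, hε, one_mul, abs_mul, abs_of_nonneg hX, abs_of_nonneg (div_nonneg
        (momentum_nonneg hα₀ hα _ _) (radialMomentum_pos hα₀ hα _ _).le)]
    exact ⟨hX, mul_le_mul_of_nonneg_right (slope_le_tan hα₀ hα _ _) hX⟩
  · have hF : ∀ t, HasDerivAt
        (fun t => -(c * turning α c (a - X * t)) - radialCost α c (a - X * t))
        (Real.exp (a - X * t) * Real.sqrt (X ^ 2 + (k (a - X * t) * X) ^ 2)) t := by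
      intro t
      refine (((hturn t).const_mul c).neg.sub (hcost t)).congr_deriv ?_
      rw [calibration_eq hα₀ hα hc _ hX rfl]
      ring
    refine (pathLength_le_of_norm_deriv_le hγd hF fun t _ => ?_).trans_eq ?_
    · rw [norm_mul, norm_mul_cexp hp, norm_eq_sqrt_re_im hε2 (w t), extremalLift_re, hwre, hwim,
        ← mul_assoc ε ε, ← pow_two, hε2, one_mul, neg_neg, ← sub_eq_add_neg]
    · simp only [mul_one, mul_zero, sub_zero]
      ring_nf

/-! ### The shape of extremals: lines and spirals -/

theorem tracesSegment_of_affine {γ : ℝ → ℂ} {m : ℝ} (hm : 0 ≤ m) {A B : ℂ} {s : ℝ → ℝ}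
    (hs : ContinuousOn s (Icc 0 m)) (hanti : AntitoneOn s (Icc 0 m))
    (h : ∀ t ∈ Icc 0 m, γ t = A * s t + B) : TracesSegment γ 0 m := by
  have h0 : (0 : ℝ) ∈ Icc 0 m := ⟨le_rfl, hm⟩
  have hmm : m ∈ Icc 0 m := ⟨hm, le_rfl⟩
  have hle : s m ≤ s 0 := hanti h0 hmm hm
  refine ⟨fun t => (s 0 - s t) / (s 0 - s m), (continuousOn_const.sub hs).div_const _, ?_, ?_⟩
  · intro t ht u hu htu
    exact div_le_div_of_nonneg_right (sub_le_sub_left (hanti ht hu htu) _) (sub_nonneg.2 hle)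
  · intro t ht
    rw [AffineMap.lineMap_apply, h 0 h0, h m hmm, h t ht]
    simp only [vsub_eq_sub, vadd_eq_add, Complex.real_smul]
    rcases hle.eq_or_lt with heq | hlt
    · have : s t = s 0 := le_antisymm (hanti h0 ht ht.1) (heq ▸ hanti ht hmm ht.2)
      rw [this, heq]
      simp
    · have hne : ((s 0 : ℂ) - s m) ≠ 0 := by
        rw [← Complex.ofReal_sub]
        exact Complex.ofReal_ne_zero.2 (sub_pos.2 hlt).ne'
      push_cast
      field_simp
      ring

/-- A curve which is no longer than the distance of its endpoints runs along a segment. -/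
theorem tracesSegment_of_pathLength_le {γ : ℝ → ℂ} {K : NNReal}
    (hγ : LipschitzOnWith K γ (Icc 0 1)) (h : (pathLength γ).toReal ≤ dist (γ 0) (γ 1)) :
    TracesSegment γ 0 1 := by
  obtain ⟨V, hVlip, hV0, hV1, hV⟩ := exists_arcLength hγ
  have h0 : (0 : ℝ) ∈ Icc (0 : ℝ) 1 := ⟨le_rfl, zero_le_one⟩
  have h1 : (1 : ℝ) ∈ Icc (0 : ℝ) 1 := ⟨zero_le_one, le_rfl⟩
  have hmono : MonotoneOn V (Icc 0 1) := fun s hs t ht hst =>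
    sub_nonneg.1 (dist_nonneg.trans (hV s hs t ht hst))
  have hnn : 0 ≤ V 1 := hV0 ▸ hmono h0 h1 zero_le_one
  refine ⟨fun t => V t / V 1, hVlip.continuousOn.div_const _,
    fun s hs t ht hst => div_le_div_of_nonneg_right (hmono hs ht hst) hnn, fun t ht => ?_⟩
  have ha := hV 0 h0 t ht ht.1
  have hb := hV t ht 1 h1 ht.2
  have hab := hV 0 h0 1 h1 zero_le_one
  have htri := dist_triangle (γ 0) (γ t) (γ 1)
  have hdiv : V t / V 1 * V 1 = V t := by
    refine div_mul_cancel_of_imp fun hz => ?_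
    have := hmono h0 ht ht.1
    have := hmono ht h1 ht.2
    linarith
  have hd : dist (γ 0) (γ 1) = V 1 := by linarith
  apply eq_lineMap_of_dist_eq_mul_of_dist_eq_mul
  · rw [hd, hdiv]; linarith
  · rw [hd, sub_mul, hdiv]; linarith

theorem tracesSpiral_refl (α : ℝ) (γ : ℝ → ℂ) (a : ℝ) : TracesSpiral α γ a a := by
  refine ⟨fun _ => 0, rfl, continuousOn_const, monotoneOn_const, Or.inl fun t ht => ?_⟩
  rw [Icc_self, mem_singleton_iff] at ht
  simp [ht, rightSpiral]

/-- Where the angular momentum equals `c`, the extremal runs along a straight line. -/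
theorem exists_extremal_eq_line {α : ℝ} (hα₀ : 0 ≤ α) (hα : α < Real.pi / 2) {c ε : ℝ}
    (hc : 0 ≤ c) (hε2 : ε ^ 2 = 1) {y : ℝ} (hy : c ≤ Real.exp y * Real.sin α) :
    ∃ A : ℂ, ∀ x, y ≤ x → Complex.exp (x - (ε * turning α c x : ℝ) * Complex.I) =
      A * (Real.sqrt (Real.exp x ^ 2 - c ^ 2) + (ε * c : ℝ) * Complex.I) := by
  have hsin := sin_nonneg_of_restricting hα₀ hα
  have hcx : ∀ x, y ≤ x → momentum α c x = c := fun x hx =>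
    momentum_of_le hc (hy.trans (mul_le_mul_of_nonneg_right (Real.exp_le_exp.2 hx) hsin))
  have hpos : ∀ x, y ≤ x → 0 < Real.exp x ^ 2 - c ^ 2 := fun x hx => by
    have := momentum_sq_lt hα₀ hα c x
    rw [hcx x hx] at this
    linarith
  -- On a line at distance `c` from the root, `S x` is the distance from the foot of the
  -- perpendicular to the point at radius `exp x`.
  set S : ℝ → ℝ := fun x => Real.sqrt (Real.exp x ^ 2 - c ^ 2) with hS
  have hSpos : ∀ x, y ≤ x → 0 < S x := fun x hx => Real.sqrt_pos.2 (hpos x hx)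
  have hSsq : ∀ x, y ≤ x → S x ^ 2 = Real.exp x ^ 2 - c ^ 2 := fun x hx =>
    Real.sq_sqrt (hpos x hx).le
  have hSd : ∀ x, y ≤ x → HasDerivAt S (Real.exp x ^ 2 / S x) x := by
    intro x hx
    refine ((((Real.hasDerivAt_exp x).pow 2).sub_const (c ^ 2)).sqrt (hpos x hx).ne').congr_deriv ?_
    simp only [Nat.cast_ofNat, Pi.pow_apply]
    have := (hSpos x hx).ne'
    simp only [hS] at this ⊢
    field_simp
    norm_num
  -- `Q` is the quotient of the point on the model line by the point on the extremal; it is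
  -- constant, and `A` is its inverse.
  set Q : ℝ → ℂ := fun x => Complex.exp (-(x : ℂ) + (ε * turning α c x : ℝ) * Complex.I) *
    (S x + (ε * c : ℝ) * Complex.I) with hQ
  have hQd : ∀ x, y ≤ x → HasDerivAt Q 0 x := by
    intro x hx
    have hn : radialMomentum α c x = S x := by rw [radialMomentum, hcx x hx]
    have hk := hasDerivAt_turning hα₀ hα c x
    rw [hn, hcx x hx] at hk
    have h1 := ((hasDerivAt_id x).ofReal_comp.neg.add
      ((hk.const_mul ε).ofReal_comp.mul_const Complex.I)).cexp
    have h2 := (hSd x hx).ofReal_comp.add_const (((ε * c : ℝ) : ℂ) * Complex.I)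
    refine (h1.mul h2).congr_deriv ?_
    have hS0 : (S x : ℂ) ≠ 0 := Complex.ofReal_ne_zero.2 (hSpos x hx).ne'
    have hsqC : (S x : ℂ) ^ 2 = (Real.exp x : ℂ) ^ 2 - (c : ℂ) ^ 2 := by
      exact_mod_cast congrArg (fun r : ℝ => (r : ℂ)) (hSsq x hx)
    have hεC : (ε : ℂ) ^ 2 = 1 := by exact_mod_cast congrArg (fun r : ℝ => (r : ℂ)) hε2
    have hzero : (-1 + ((ε * (c / S x) : ℝ) : ℂ) * Complex.I) * (S x + ((ε * c : ℝ) : ℂ) * Complex.I)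
        + ((Real.exp x ^ 2 / S x : ℝ) : ℂ) = 0 := by
      push_cast at hsqC ⊢
      field_simp
      linear_combination (-1 : ℂ) * hsqC + (ε : ℂ) ^ 2 * (c : ℂ) ^ 2 * Complex.I_sq
        - (c : ℂ) ^ 2 * hεC
    simp only [Pi.add_apply, Pi.neg_apply, id, Complex.ofReal_one]
    linear_combination Complex.exp (-(x : ℂ) + (ε * turning α c x : ℝ) * Complex.I) * hzero
  have hQc : ∀ x, y ≤ x → Q x = Q y := fun x hx =>
    constant_of_has_deriv_right_zero (a := y) (b := x)
      (fun z hz => (hQd z hz.1).continuousAt.continuousWithinAt)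
      (fun z hz => (hQd z hz.1).hasDerivWithinAt) x ⟨hx, le_rfl⟩
  have hQy : Q y ≠ 0 := by
    refine mul_ne_zero (Complex.exp_ne_zero _) fun h => ?_
    have := congrArg Complex.re h
    simp at this
    exact (hSpos y le_rfl).ne' this
  refine ⟨(Q y)⁻¹, fun x hx => ?_⟩
  rw [← hQc x hx] at hQy ⊢
  rw [eq_inv_mul_iff_mul_eq₀ hQy]
  simp only [hQ]
  rw [mul_right_comm, ← Complex.exp_add]
  simp [hS]

/-- Extremals are straight segments followed by spiral segments. -/
theorem isStraightThenSpiral_of_extremal {α : ℝ} (hα₀ : 0 ≤ α) (hα : α < Real.pi / 2) {c ε : ℝ}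
    (hc : 0 ≤ c) (hε : ε = 1 ∨ ε = -1) {γ : ℝ → ℂ} {P : ℂ} {x : ℝ → ℝ}
    (hx : ContinuousOn x (Icc 0 1)) (hanti : AntitoneOn x (Icc 0 1))
    (hcx : c ≤ Real.exp (x 0) * Real.sin α)
    (h : ∀ t ∈ Icc (0 : ℝ) 1,
      γ t = P * Complex.exp (x t - (ε * turning α c (x t) : ℝ) * Complex.I)) :
    IsStraightThenSpiral α γ := by
  have hsin := sin_nonneg_of_restricting hα₀ hα
  have hε2 : ε ^ 2 = 1 := by rcases hε with rfl | rfl <;> norm_num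
  -- The switch occurs when `exp x * sin α` has fallen to `c`; if it stays above `c`, the whole path
  -- is straight and `m = 1`.
  have hlevel : ∃ m ∈ Icc (0 : ℝ) 1, c ≤ Real.exp (x m) * Real.sin α ∧
      (m = 1 ∨ Real.exp (x m) * Real.sin α ≤ c) := by
    rcases le_total c (Real.exp (x 1) * Real.sin α) with h1 | h1
    · exact ⟨1, ⟨zero_le_one, le_rfl⟩, h1, Or.inl rfl⟩
    · obtain ⟨m, hm, hmc⟩ := intermediate_value_Icc' zero_le_one
        ((Real.continuous_exp.comp_continuousOn hx).mul_const (Real.sin α)) ⟨h1, hcx⟩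
      exact ⟨m, hm, hmc.ge, Or.inr hmc.le⟩
  obtain ⟨m, hm, hge, hle⟩ := hlevel
  have hsub : Icc 0 m ⊆ Icc (0 : ℝ) 1 := Icc_subset_Icc_right hm.2
  have hsub' : Icc m 1 ⊆ Icc (0 : ℝ) 1 := Icc_subset_Icc_left hm.1
  refine ⟨m, hm, ?_, ?_⟩
  · obtain ⟨A, hA⟩ := exists_extremal_eq_line hα₀ hα hc hε2 hge
    refine tracesSegment_of_affine hm.1 (A := P * A) (B := P * A * ((ε * c : ℝ) * Complex.I))
      (s := fun t => Real.sqrt (Real.exp (x t) ^ 2 - c ^ 2)) ?_ ?_ ?_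
    · exact Real.continuous_sqrt.comp_continuousOn
        (((Real.continuous_exp.comp_continuousOn (hx.mono hsub)).pow 2).sub continuousOn_const)
    · intro s hs t ht hst
      exact Real.sqrt_le_sqrt (sub_le_sub_right (pow_le_pow_left₀ (Real.exp_pos _).le
        (Real.exp_le_exp.2 (hanti (hsub hs) (hsub ht) hst)) 2) _)
    · intro t ht
      rw [h t (hsub ht), hA (x t) (hanti (hsub ht) hm ht.2)]
      ring
  · rcases hle with rfl | hle
    · exact tracesSpiral_refl α γ 1
    have hturn : ∀ t ∈ Icc m 1, turning α c (x m) - turning α c (x t) =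
        Real.tan α * (x m - x t) := by
      intro t ht
      have hcont : Continuous fun s => momentum α c s / radialMomentum α c s :=
        (continuous_slope hα₀ hα).comp (Continuous.prodMk_right c)
      have hxt : x t ≤ x m := hanti hm (hsub' ht) ht.1
      rw [turning, turning, intervalIntegral.integral_interval_sub_left
        (hcont.intervalIntegrable _ _) (hcont.intervalIntegrable _ _),
        intervalIntegral.integral_congr (g := fun _ => Real.tan α)]
      · simp [mul_comm]
      · intro s hs
        rw [uIcc_of_le hxt] at hs
        exact slope_of_ge hα₀ hα hc
          ((mul_le_mul_of_nonneg_right (Real.exp_le_exp.2 hs.2) hsin).trans hle)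
    have hspiral : ∀ t ∈ Icc m 1, γ t = γ m * (Real.exp (-(x m - x t)) : ℂ) *
        Complex.exp (((ε * Real.tan α * (x m - x t) : ℝ) : ℂ) * Complex.I) := by
      intro t ht
      rw [h t (hsub' ht), h m hm, mul_assoc, mul_assoc, Complex.ofReal_exp, ← Complex.exp_add,
        ← Complex.exp_add, mul_assoc ε, ← hturn t ht]
      congr 2
      push_cast
      ring
    refine ⟨fun t => x m - x t, sub_self _, continuousOn_const.sub (hx.mono hsub'),
      fun s hs t ht hst => sub_le_sub_left (hanti (hsub' hs) (hsub' ht) hst) _, ?_⟩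
    rcases hε with rfl | rfl
    · left
      intro t ht
      rw [hspiral t ht, rightSpiral, one_mul]
    · right
      intro t ht
      rw [hspiral t ht, leftSpiral, rightSpiral, Real.tan_neg, neg_one_mul]

/-! ### Shortest paths and the exchange of arcs -/

/-- Logarithmic coordinates fail at the root, but the straight segment to it has angle zero and is
therefore admissible. -/
theorem shortestPath_of_target_eq_zero {α : ℝ} (hα₀ : 0 ≤ α) {p : ℂ} :
    (∃ γ : ℝ → ℂ, IsShortestPath α γ p 0) ∧
      ∀ γ : ℝ → ℂ, IsShortestPath α γ p 0 → IsStraightThenSpiral α γ := by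
  have hd : ∀ t : ℝ, HasDerivAt (fun t : ℝ => p * (1 - t : ℝ)) (-p) t := fun t =>
    ((((hasDerivAt_id t).const_sub 1).ofReal_comp).const_mul p).congr_deriv (by simp)
  have hpath : IsAngleRestrictedPath α (fun t : ℝ => p * (1 - t : ℝ)) p 0 := by
    refine ⟨by simp, by simp, ⟨‖p‖₊, ?_⟩, ?_⟩
    · refine LipschitzOnWith.of_dist_le_mul fun s _ t _ => ?_
      rw [dist_eq_norm, ← mul_sub, norm_mul, ← Complex.ofReal_sub, Complex.norm_real,
        Real.dist_eq, coe_nnnorm, Real.norm_eq_abs, ← abs_neg]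
      ring_nf
      rfl
    -- At `t = 1` the vector to the root is zero, and its angle with any vector is `π / 2` by
    -- convention.
    · have hne1 : ∀ᵐ x : ℝ, x ≠ 1 := by simp [ae_iff, measure_singleton]
      rw [ae_restrict_iff' measurableSet_Icc]
      filter_upwards [hne1] with t ht1 ht h0
      have hlt : 0 < 1 - t := sub_pos.2 (lt_of_le_of_ne ht.2 ht1)
      rw [(hd t).deriv] at h0 ⊢
      have : 0 - p * ((1 - t : ℝ) : ℂ) = (1 - t) • -p := by
        rw [Complex.real_smul]; ring
      rw [this, InnerProductGeometry.angle_smul_left_of_pos _ _ hlt,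
        InnerProductGeometry.angle_self h0]
      exact hα₀
  obtain ⟨K₀, hK₀⟩ := hpath.lipschitz
  have hlen : (pathLength (fun t : ℝ => p * (1 - t : ℝ))).toReal ≤ ‖p‖ := by
    have h := pathLength_le_of_norm_deriv_le hd
      (fun t => (hasDerivAt_id t).const_mul ‖p‖) (fun t _ => by simp)
    simpa using h
  have hlow : ∀ δ : ℝ → ℂ, IsAngleRestrictedPath α δ p 0 →
      ENNReal.ofReal ‖p‖ ≤ pathLength δ := by
    intro δ hδ
    have h := eVariationOn.edist_le δ (s := Icc 0 1) ⟨le_rfl, zero_le_one⟩ ⟨zero_le_one, le_rfl⟩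
    rwa [hδ.source, hδ.target, edist_dist, dist_zero_right] at h
  refine ⟨⟨_, hpath, fun δ hδ =>
    (ENNReal.le_ofReal_iff_toReal_le (pathLength_ne_top hK₀) (norm_nonneg p)).2 hlen |>.trans
      (hlow δ hδ)⟩, fun γ hγ => ?_⟩
  obtain ⟨K, hK⟩ := hγ.1.lipschitz
  refine ⟨1, ⟨zero_le_one, le_rfl⟩, tracesSegment_of_pathLength_le hK ?_, tracesSpiral_refl α γ 1⟩
  rw [hγ.1.source, hγ.1.target, dist_zero_right]
  exact (ENNReal.toReal_mono (pathLength_ne_top hK₀) (hγ.2 _ hpath)).trans hlen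

/-- The parameter `c` is tuned to the least possible turning `|arg (q / p)|`. Since `c ≥ 0`, turning
further cannot lower the calibration bound, so one `c` serves for paths of every winding. -/
theorem shortestPath_of_target_ne_zero {α : ℝ} (hα₀ : 0 ≤ α)
    (hα : α < Real.pi / 2) {p q : ℂ} (hq : q ≠ 0) (hpq : q ∈ spiralRegion α p) :
    (∃ γ : ℝ → ℂ, IsShortestPath α γ p q) ∧
      ∀ γ : ℝ → ℂ, IsShortestPath α γ p q → IsStraightThenSpiral α γ := by
  have h0 : (0 : ℝ) ∈ Icc (0 : ℝ) 1 := ⟨le_rfl, zero_le_one⟩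
  have h1 : (1 : ℝ) ∈ Icc (0 : ℝ) 1 := ⟨zero_le_one, le_rfl⟩
  obtain ⟨γ₀, hγ₀⟩ := hpq
  have hp : p ≠ 0 := by
    have h := hγ₀.norm_le hα₀ hα h0 h1 zero_le_one
    rw [hγ₀.source, hγ₀.target] at h
    exact norm_pos_iff.1 ((norm_pos_iff.2 hq).trans_le h)
  set a := Real.log ‖p‖ with ha
  set X := a - Real.log ‖q‖ with hX
  -- The velocity of a lift lies in a convex cone, hence so does its total increment; this makes
  -- `|arg (q / p)|` admissible for `exists_turning_eq`.
  have hcone : ∀ (W : ℝ → ℂ) (C : NNReal), LipschitzOnWith C W (Icc 0 1) →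
      (∀ᵐ t, t ∈ Ioo (0 : ℝ) 1 → ∃ w, HasDerivAt W w t ∧ 0 ≤ -w.re ∧
        |w.im| ≤ Real.tan α * -w.re) →
      AntitoneOn (fun t => (W t).re) (Icc 0 1) ∧
        ∀ σ : ℝ, |σ| = 1 → σ * (W 1).im - σ * (W 0).im ≤
          Real.tan α * ((W 0).re - (W 1).re) := by
    intro W C hW hae
    have hre : AbsolutelyContinuousOnInterval (fun t => (W t).re) 0 1 :=
      absolutelyContinuous_of_lipschitzOnWith (Complex.reCLM.lipschitz.comp_lipschitzOnWith hW)
    have him : AbsolutelyContinuousOnInterval (fun t => (W t).im) 0 1 :=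
      absolutelyContinuous_of_lipschitzOnWith (Complex.imCLM.lipschitz.comp_lipschitzOnWith hW)
    constructor
    · have hm := monotoneOn_of_ae_hasDerivAt_nonneg hre.fun_neg (by
        filter_upwards [hae] with t ht hmem
        obtain ⟨w, hw, hw0, -⟩ := ht hmem
        exact ⟨_, (hasDerivAt_re hw).neg, hw0⟩)
      exact fun s hs t ht hst => neg_le_neg_iff.1 (hm hs ht hst)
    · intro σ hσ
      have hm := monotoneOn_of_ae_hasDerivAt_nonneg
          ((hre.const_mul (-Real.tan α)).fun_sub (him.const_mul σ)) (by
        filter_upwards [hae] with t ht hmem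
        obtain ⟨w, hw, -, hw1⟩ := ht hmem
        refine ⟨_, ((hasDerivAt_re hw).const_mul _).sub ((hasDerivAt_im hw).const_mul σ), ?_⟩
        have h2 : σ * w.im ≤ |w.im| := by
          refine (le_abs_self _).trans_eq ?_
          rw [abs_mul, hσ, one_mul]
        linarith)
      have h3 := hm h0 h1 zero_le_one
      simp only at h3
      linarith
  have hsign : ∀ y : ℝ, ∃ σ : ℝ, (σ = 1 ∨ σ = -1) ∧ σ * y = |y| := by
    intro y
    rcases le_total 0 y with hy | hy
    · exact ⟨1, Or.inl rfl, by rw [one_mul, abs_of_nonneg hy]⟩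
    · exact ⟨-1, Or.inr rfl, by rw [neg_one_mul, abs_of_nonpos hy]⟩
  have habs : ∀ σ : ℝ, (σ = 1 ∨ σ = -1) → |σ| = 1 := by
    rintro σ (rfl | rfl) <;> simp
  have hre1 : ∀ z : ℂ, q = p * Complex.exp z → z.re = -X := by
    intro z hz
    have h := congrArg Real.log (norm_mul_cexp hp z)
    rw [← hz, Real.log_exp] at h
    rw [hX]
    linarith
  set Δ := |Complex.arg (q / p)| with hΔ
  have hXΔ : 0 ≤ X ∧ Δ ≤ Real.tan α * X := by
    obtain ⟨W, C, hW, hW0, hγW, hae⟩ := hγ₀.exists_lift hα₀ hα hq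
    obtain ⟨hm, hc⟩ := hcone W C hW (by
      filter_upwards [hae] with t ht hmem
      obtain ⟨w, hw, -, hw2⟩ := ht hmem
      exact ⟨w, hw, hw2⟩)
    have hqW : q = p * Complex.exp (W 1) := by rw [← hγW 1 h1, hγ₀.target]
    obtain ⟨σ, hσ, hσy⟩ := hsign (W 1).im
    have h2 := hc σ (habs σ hσ)
    have h3 := hm h0 h1 zero_le_one
    simp only [hW0, Complex.zero_re, Complex.zero_im, hre1 _ hqW] at h2 h3
    refine ⟨by linarith, (abs_arg_div_le_abs_im hp hqW).trans ?_⟩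
    rw [← hσy]
    linarith
  obtain ⟨hX0, hΔX⟩ := hXΔ
  obtain ⟨c, hc, hcle, hcΔ⟩ := exists_turning_eq hα₀ hα (Δ := Δ) (x₀ := a) (x₁ := a - X) (by linarith)
    (abs_nonneg _) (by rwa [sub_sub_cancel])
  obtain ⟨ε, hε, hεy⟩ := hsign (Complex.arg (q / p))
  have hε2 : ε * ε = 1 := by rcases hε with rfl | rfl <;> norm_num
  have hqZ : q = p * Complex.exp (extremalLift α c ε a X 1) := by
    have hlift : extremalLift α c ε a X 1 = Complex.log (q / p) := by
      apply Complex.ext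
      · rw [extremalLift_re, Complex.log_re, norm_div, Real.log_div (norm_ne_zero_iff.2 hq)
          (norm_ne_zero_iff.2 hp), hX, mul_one]
        ring
      · rw [extremalLift_im, Complex.log_im, mul_one, hcΔ, hΔ, ← hεy, ← mul_assoc, hε2, one_mul]
    rw [hlift, Complex.exp_log (div_ne_zero hq hp), mul_div_cancel₀ _ hp]
  obtain ⟨η, hη, hηlen⟩ := exists_extremal_path hα₀ hα hc (habs ε hε) hp hX0 hqZ
  rw [← ha, hcΔ] at hηlen
  obtain ⟨Kη, hKη⟩ := hη.lipschitz
  set M := c * Δ + (radialCost α c a - radialCost α c (a - X)) with hM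
  have hkey : ∀ δ : ℝ → ℂ, IsAngleRestrictedPath α δ p q → M ≤ (pathLength δ).toReal ∧
      ((pathLength δ).toReal ≤ M → IsStraightThenSpiral α δ) := by
    intro δ hδ
    obtain ⟨K, hK⟩ := hδ.lipschitz
    obtain ⟨W, C, hW, hW0, hδW, hae⟩ := hδ.exists_lift hα₀ hα hq
    have hqW : q = p * Complex.exp (W 1) := by rw [← hδW 1 h1, hδ.target]
    -- The sign is that of the turning of `δ` itself, which may differ from `ε`.
    obtain ⟨σ, hσ, hσy⟩ := hsign (W 1).im
    obtain ⟨hlow, heq⟩ := calibration_le_pathLength hα₀ hα hc (habs σ hσ) hp hK hW hW0 hδW hae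
    rw [hσy, hre1 _ hqW, ← ha, ← sub_eq_add_neg] at hlow heq
    have hΔW := mul_le_mul_of_nonneg_left (abs_arg_div_le_abs_im hp hqW) hc
    refine ⟨by linarith, fun hle => ?_⟩
    have hturn := heq (by linarith)
    obtain ⟨hm, -⟩ := hcone W C hW (by
      filter_upwards [hae] with t ht hmem
      obtain ⟨w, hw, -, hw2⟩ := ht hmem
      exact ⟨w, hw, hw2⟩)
    have hσ2 : σ * σ = 1 := by rcases hσ with rfl | rfl <;> norm_num
    refine isStraightThenSpiral_of_extremal hα₀ hα hc hσ (x := fun t => a + (W t).re)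
      (P := p * Complex.exp (-(a : ℂ) + ((σ * turning α c a : ℝ) : ℂ) * Complex.I))
      (continuousOn_const.add (Complex.continuous_re.comp_continuousOn hW.continuousOn))
      (fun s hs t ht hst => add_le_add_right (hm hs ht hst) a) ?_ ?_
    · simpa [hW0] using hcle
    · intro t ht
      have him : (W t).im = σ * (turning α c a - turning α c (a + (W t).re)) := by
        rw [← hturn t ht, ← mul_assoc, hσ2, one_mul]
      rw [hδW t ht, mul_assoc, ← Complex.exp_add]
      congr 2
      conv_lhs => rw [← Complex.re_add_im (W t), him]
      push_cast
      ring
  refine ⟨⟨η, hη, fun δ hδ => ?_⟩, fun γ hγ => (hkey γ hγ.1).2 ?_⟩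
  · obtain ⟨K, hK⟩ := hδ.lipschitz
    exact (ENNReal.toReal_le_toReal (pathLength_ne_top hKη) (pathLength_ne_top hK)).1
      (hηlen.trans (hkey δ hδ).1)
  · exact (ENNReal.toReal_mono (pathLength_ne_top hKη) (hγ.2 η hη)).trans hηlen

/-- Every arc of an optimal flux tree is a shortest path: exchanging it for another path between
the same nodes gives another flux tree. -/
theorem FluxTree.IsOptimal.isShortestPath_arc {α : ℝ} {n : ℕ} {t : Fin n → ℂ} {T : FluxTree α t}
    (hT : T.IsOptimal) {v : T.Node} (hv : v ≠ T.root) :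
    IsShortestPath α (T.arc v) (T.pos v) (T.pos (T.parent v)) := by
  refine ⟨T.arc_restricted v hv, fun δ hδ => ?_⟩
  set T' : FluxTree α t :=
    { T with
      arc := Function.update T.arc v δ
      arc_restricted := fun u hu => by
        rcases eq_or_ne u v with rfl | huv
        · rwa [Function.update_self]
        · rw [Function.update_of_ne huv]
          exact T.arc_restricted u hu } with hT'
  have hle : T.length ≤ T'.length := hT T'
  have hmem : v ∈ Finset.univ.filter (fun u : T.Node => u ≠ T.root) := by simpa using hv
  have hlen : T.length = pathLength (T.arc v) +
      ∑ u ∈ (Finset.univ.filter (fun u : T.Node => u ≠ T.root)).erase v,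
        pathLength (T.arc u) :=
    (Finset.add_sum_erase _ _ hmem).symm
  have hlen' : T'.length = pathLength δ +
      ∑ u ∈ (Finset.univ.filter (fun u : T.Node => u ≠ T.root)).erase v,
        pathLength (T.arc u) := by
    have h1 : T'.length = pathLength (Function.update T.arc v δ v) +
        ∑ u ∈ (Finset.univ.filter (fun u : T.Node => u ≠ T.root)).erase v,
          pathLength (Function.update T.arc v δ u) :=
      (Finset.add_sum_erase _ _ hmem).symm
    rw [h1, Function.update_self]
    congr 1
    refine Finset.sum_congr rfl fun u hu => ?_
    rw [Function.update_of_ne (Finset.ne_of_mem_erase hu)]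
  rw [hlen, hlen'] at hle
  -- Cancelling the other arcs requires their total length to be finite.
  refine (ENNReal.add_le_add_iff_right (ENNReal.sum_ne_top.2 fun u hu => ?_)).1 hle
  obtain ⟨K, hK⟩ := (T.arc_restricted u
    (Finset.mem_filter.1 (Finset.mem_of_mem_erase hu)).2).lipschitz
  exact pathLength_ne_top hK

end FluxTrees

theorem mainTheorem10 (α : ℝ) (hα₀ : 0 ≤ α) (hα : α < Real.pi / 2) :
    (∀ p : ℂ, ∀ q ∈ FluxTrees.spiralRegion α p,
      (∃ γ : ℝ → ℂ, FluxTrees.IsShortestPath α γ p q) ∧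
      ∀ γ : ℝ → ℂ, FluxTrees.IsShortestPath α γ p q → FluxTrees.IsStraightThenSpiral α γ) ∧
    (∀ (n : ℕ) (t : Fin n → ℂ) (T : FluxTrees.FluxTree α t), T.IsOptimal →
      ∀ v : T.Node, v ≠ T.root → FluxTrees.IsStraightThenSpiral α (T.arc v)) := by
  have hpath : ∀ p : ℂ, ∀ q ∈ FluxTrees.spiralRegion α p,
      (∃ γ : ℝ → ℂ, FluxTrees.IsShortestPath α γ p q) ∧
      ∀ γ : ℝ → ℂ, FluxTrees.IsShortestPath α γ p q → FluxTrees.IsStraightThenSpiral α γ := by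
    intro p q hpq
    by_cases hq : q = 0
    · subst hq
      exact FluxTrees.shortestPath_of_target_eq_zero hα₀
    · exact FluxTrees.shortestPath_of_target_ne_zero hα₀ hα hq hpq
  refine ⟨hpath, fun n t T hT v hv => ?_⟩
  exact (hpath _ _ ⟨_, T.arc_restricted v hv⟩).2 _ (hT.isShortestPath_arc hv)
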